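/- Let $k$ be a field. For a polynomial ring $k[x_1,\dots,x_n]$ and vectors $\alpha_1,\dots,\alpha_n\in\mathbb Z^m$ ($m\ge 0$), consider the $k$-algebra morphism $\varphi:k[x_1,\dots,x_n]\to k[t_1^{\pm1},\dots,t_m^{\pm1}]$, $\varphi(x_i)=\mathbf t^{\alpha_i}$. An ideal of the form $\ker\varphi$ is called toric; it is called minimally toric if $\varphi$ can be chosen such that, moreover, $\mathbf t^{\alpha_1},\dots,\mathbf t^{\alpha_n}$ form a minimal system of generators of the algebra $k[\mathbf t^{\alpha_1},\dots,\mathbf t^{\alpha_n}]$ (no $\mathbf t^{\alpha_i}$ lies in the subalgebra generated by the $\mathbf t^{\alpha_j}$ with $j\ne i$). Homogeneous means homogeneous for the standard grading, where every variable has degree $1$. **Theorem.** Let $\mathbf z_1=\{z_{1,1},\dots,z_{1,n_1}\}$ and $\mathbf z_2=\{z_{2,1},\dots,z_{2,n_2}\}$ be two disjoint finite sets of variables and let $x$ be a further variable. Let $I_1\subset k[\mathbf z_1,x]$ and $I_2\subset k[\mathbf z_2,x]$ be homogeneous toric ideals such that, for each $i\in\{1,2\}$, the variable $x$ appears in at least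 one element of some (inclusion-)minimal generating set of $I_i$. Let $I_1+I_2$ denote the sum of the ideals that $I_1$ and $I_2$ generate in $k[\mathbf z_1,\mathbf z_2,x]$. Then: 1. $I_1+I_2$ is a homogeneous toric ideal of $k[\mathbf z_1,\mathbf z_2,x]$; if moreover $I_1$ and $I_2$ are minimally toric, then so is $I_1+I_2$. 2. For Krull dimensions, $\dim k[\mathbf z_1,\mathbf z_2,x]/(I_1+I_2)=\dim k[\mathbf z_1,x]/I_1+\dim k[\mathbf z_2,x]/I_2-1$. -/

import Mathlib

open MvPolynomial

namespace ToricSum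

noncomputable section

/-- The Laurent polynomial ring `k[t₁^{±1}, …, tₘ^{±1}]`, i.e. the group algebra of `ℤᵐ`. -/
abbrev Laurent (k : Type*) [Field k] (m : ℕ) : Type _ := AddMonoidAlgebra k (Fin m → ℤ)

/-- The Laurent monomial `t^α`. -/
def laurentMonomial (k : Type*) [Field k] {m : ℕ} (α : Fin m → ℤ) : Laurent k m :=
  AddMonoidAlgebra.single α 1

/-- The monomial morphism `k[x_i : i ∈ σ] → k[t^{±1}]`, `x_i ↦ t^{A i}`. -/
def monomialMap (k : Type*) [Field k] {σ : Type*} {m : ℕ} (A : σ → Fin m → ℤ) :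
    MvPolynomial σ k →ₐ[k] Laurent k m :=
  aeval fun i => laurentMonomial k (A i)

/-- The monomials `t^{A i}`, `i ∈ σ`, form a minimal system of generators of the algebra
`k[t^{A i} : i ∈ σ]`: none of them lies in the subalgebra generated by the others. -/
def IsMinimalFamily (k : Type*) [Field k] {σ : Type*} {m : ℕ} (A : σ → Fin m → ℤ) : Prop :=
  ∀ i : σ, laurentMonomial k (A i) ∉
    Algebra.adjoin k ((fun j => laurentMonomial k (A j)) '' {j | j ≠ i})

/-- An ideal of a polynomial ring is toric if it is the kernel of a monomial morphism
to a Laurent polynomial ring. -/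
def IsToric {k : Type*} [Field k] {σ : Type*} (I : Ideal (MvPolynomial σ k)) : Prop :=
  ∃ (m : ℕ) (A : σ → Fin m → ℤ), RingHom.ker (monomialMap k A) = I

/-- A toric ideal having a parametrization by a minimal system of algebra generators. -/
def IsMinimallyToric {k : Type*} [Field k] {σ : Type*} (I : Ideal (MvPolynomial σ k)) : Prop :=
  ∃ (m : ℕ) (A : σ → Fin m → ℤ), IsMinimalFamily k A ∧ RingHom.ker (monomialMap k A) = I

/-- Homogeneity for the standard grading, in which every variable has degree one. -/
def IsHomogeneousIdeal {k : Type*} [Field k] {σ : Type*} (I : Ideal (MvPolynomial σ k)) : Prop :=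
  letI : GradedAlgebra (homogeneousSubmodule σ k) := MvPolynomial.gradedAlgebra
  Ideal.IsHomogeneous (homogeneousSubmodule σ k) I

/-- `G` generates `I` and no proper subset of `G` does. -/
def IsMinimalGeneratingSet {k : Type*} [Field k] {σ : Type*}
    (I : Ideal (MvPolynomial σ k)) (G : Set (MvPolynomial σ k)) : Prop :=
  Minimal (fun S : Set (MvPolynomial σ k) => Ideal.span S = I) G

/-- The variable `v` occurs in some element of some minimal generating set of `I`. -/
def OccursInMinimalGenerators {k : Type*} [Field k] {σ : Type*}
    (I : Ideal (MvPolynomial σ k)) (v : σ) : Prop :=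
  ∃ G : Set (MvPolynomial σ k), IsMinimalGeneratingSet I G ∧ ∃ g ∈ G, v ∈ g.vars

/-- The inclusion `k[z₁, x] ⊆ k[z₁, z₂, x]`; the variable `x` is indexed by `none`. -/
def inclLeft (k : Type*) [Field k] (σ₁ σ₂ : Type*) :
    MvPolynomial (Option σ₁) k →ₐ[k] MvPolynomial (Option (σ₁ ⊕ σ₂)) k :=
  rename (Option.map Sum.inl)

/-- The inclusion `k[z₂, x] ⊆ k[z₁, z₂, x]`; the variable `x` is indexed by `none`. -/
def inclRight (k : Type*) [Field k] (σ₁ σ₂ : Type*) :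
    MvPolynomial (Option σ₂) k →ₐ[k] MvPolynomial (Option (σ₁ ⊕ σ₂)) k :=
  rename (Option.map Sum.inr)

/-- The ideal `I₁ + I₂` of `k[z₁, z₂, x]`: the sum of the ideals that `I₁ ⊆ k[z₁, x]` and
`I₂ ⊆ k[z₂, x]` generate in `k[z₁, z₂, x]`. -/
def sumIdeal {k : Type*} [Field k] {σ₁ σ₂ : Type*} (I₁ : Ideal (MvPolynomial (Option σ₁) k))
    (I₂ : Ideal (MvPolynomial (Option σ₂) k)) : Ideal (MvPolynomial (Option (σ₁ ⊕ σ₂)) k) :=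
  I₁.map (inclLeft k σ₁ σ₂) + I₂.map (inclRight k σ₁ σ₂)

end

end ToricSum

/-! A toric ideal is determined by which pairs of exponents have the same image
(`ker_monomialMap_eq`). Homogeneity makes total degree a function of that image, so subtracting the
vector of `x` from all vectors and adjoining a coordinate 1 does not change the kernel. Both ideals
then come from vectors `(1, A i)` with `x` at `(1, 0)`, and gluing places the two families in
complementary coordinates over the shared 1.

The glued kernel is the sum (`sumIdeal_eq_ker`): in a binomial `p q - p' q'` of the glued kernel,
any degree lost on one side is gained on the other, and a power `x ^ d` transfers it, via `p q - p'
q' = p (q - x ^ d q') + q' (p x ^ d - p')`.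

Dimension is the rank of the exponents. If the families `A₁`, `A₂` have ranks `r₁`, `r₂`, the three
rings have dimensions `r₁ + 1`, `r₂ + 1` and `r₁ + r₂ + 1`. For vectors of height 1, minimality
amounts to distinctness, which gluing preserves. -/

namespace ToricSum

/-! ### Krull dimension and transcendence bases -/

section KrullDimension

/-- An injective integral extension preserves the Krull dimension. -/
theorem ringKrullDim_eq_of_isIntegral (R S : Type*) [CommRing R] [CommRing S] [Algebra R S]
    [Algebra.IsIntegral R S] (h : Function.Injective (algebraMap R S)) :
    ringKrullDim S = ringKrullDim R := by
  apply le_antisymm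
  · refine Order.krullDim_le_of_strictMono (PrimeSpectrum.comap (algebraMap R S)) ?_
    intro p q hpq
    exact Ideal.IsIntegral.comap_lt_comap (R := R) (I := p.asIdeal) (J := q.asIdeal) hpq
  -- Lying over lifts the smallest prime of the chain, and going up lifts the rest.
  · refine iSup_le fun l => ?_
    obtain ⟨P, hP, hPl⟩ := Ideal.exists_ideal_over_prime_of_isIntegral (S := S) l.head.asIdeal ⊥ (by
      intro x hx
      have : algebraMap R S x = 0 := by simpa using hx
      rw [(injective_iff_map_eq_zero _).1 h x this]
      exact zero_mem _)
    have hlo : P.LiesOver l.head.asIdeal := ⟨hPl.2.symm⟩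
    have := hPl.1
    obtain ⟨L, hL, -⟩ := Ideal.exists_ltSeries_of_hasGoingUp l P
    rw [← hL]
    exact Order.LTSeries.length_le_krullDim L

/-- The Krull dimension of an affine domain is the size of any transcendence basis. -/
theorem ringKrullDim_eq_card_of_isTranscendenceBasis (k B : Type*) [Field k] [CommRing B]
    [IsDomain B] [Algebra k B] [Algebra.FiniteType k B] {ι : Type*} {x : ι → B}
    (hx : IsTranscendenceBasis k x) : ringKrullDim B = Nat.card ι := by
  -- Noether normalization: its variables form another transcendence basis of `B`, so `s` is the
  -- size of `ι`.
  obtain ⟨s, g, hg, hgi⟩ := exists_integral_inj_algHom_of_fg k B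
  algebraize [g.toRingHom]
  have : IsScalarTower k (MvPolynomial (Fin s) k) B := .of_algebraMap_eq fun r => (g.commutes r).symm
  have : Algebra.IsIntegral (MvPolynomial (Fin s) k) B := ⟨hgi⟩
  have hinj : Function.Injective (algebraMap (MvPolynomial (Fin s) k) B) := hg
  have : FaithfulSMul (MvPolynomial (Fin s) k) B :=
    (faithfulSMul_iff_algebraMap_injective _ _).2 hinj
  have hb := (IsTranscendenceBasis.mvPolynomial (Fin s) k).algebraMap_comp (A := B)
  have hc := congrArg Cardinal.toNat (hx.lift_cardinalMk_eq hb)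
  rw [ringKrullDim_eq_of_isIntegral (MvPolynomial (Fin s) k) B hinj,
    MvPolynomial.ringKrullDim_of_isNoetherianRing, ringKrullDim_eq_zero_of_field, zero_add]
  simp only [Cardinal.toNat_lift] at hc
  change Nat.card ι = Nat.card (Fin s) at hc
  rw [hc]

end KrullDimension

/-! ### Toric ideals and relations among exponents -/

section Exponents

variable {k : Type*} [Field k] {σ : Type*} {m : ℕ} (A : σ → Fin m → ℤ)

theorem monomialMap_monomial (u : σ →₀ ℕ) (c : k) :
    monomialMap k A (monomial u c) =
      AddMonoidAlgebra.single (Finsupp.linearCombination ℕ A u) c := by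
  rw [monomialMap, aeval_monomial]
  simp only [laurentMonomial, AddMonoidAlgebra.single_pow, one_pow, Finsupp.prod]
  rw [Finsupp.linearCombination_apply, Finsupp.sum]
  have : ∀ s : Finset σ, ∏ i ∈ s, AddMonoidAlgebra.single (u i • A i) (1 : k) =
      AddMonoidAlgebra.single (∑ i ∈ s, u i • A i) 1 := by
    classical
    intro s
    induction s using Finset.induction_on with
    | empty => simp [AddMonoidAlgebra.one_def]
    | insert a s ha ih => rw [Finset.prod_insert ha, Finset.sum_insert ha, ih]; simp
  rw [this, AddMonoidAlgebra.coe_algebraMap]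
  simp

theorem monomialMap_eq_mapDomainAlgHom :
    monomialMap k A = AddMonoidAlgebra.mapDomainAlgHom k k
      (Finsupp.linearCombination ℕ A).toAddMonoidHom := by
  apply MvPolynomial.algHom_ext
  intro i
  rw [MvPolynomial.X, monomialMap_monomial]
  simp [monomial, AddMonoidAlgebra.mapDomainAlgHom]

theorem binomial_mem_ker_monomialMap_iff (u v : σ →₀ ℕ) :
    monomial u 1 - monomial v 1 ∈ RingHom.ker (monomialMap k A) ↔
      Finsupp.linearCombination ℕ A u = Finsupp.linearCombination ℕ A v := by
  rw [RingHom.mem_ker, map_sub, monomialMap_monomial, monomialMap_monomial, sub_eq_zero]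
  refine ⟨fun h => ?_, fun h => by rw [h]⟩
  exact AddMonoidAlgebra.single_left_injective one_ne_zero h

/-- A toric ideal is contained in every ideal that contains its binomials. -/
theorem ker_monomialMap_le {J : Ideal (MvPolynomial σ k)}
    (hJ : ∀ u v : σ →₀ ℕ, Finsupp.linearCombination ℕ A u = Finsupp.linearCombination ℕ A v →
      monomial u 1 - monomial v 1 ∈ J) : RingHom.ker (monomialMap k A) ≤ J := by
  -- `invFun` picks one representative exponent per image. Moving every monomial of `p` to its
  -- representative changes `p` by an element of `J`, and the result depends only on the image of
  -- `p`, so it is zero on the kernel.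
  have key : ∀ p : MvPolynomial σ k, p - AddMonoidAlgebra.mapDomain
      (Function.invFun (Finsupp.linearCombination ℕ A)) (monomialMap k A p) ∈ J := by
    intro p
    induction p using MvPolynomial.induction_on' with
    | monomial u c =>
      rw [monomialMap_monomial, AddMonoidAlgebra.mapDomain_single]
      have h := J.mul_mem_left (C c) (hJ u
        (Function.invFun (Finsupp.linearCombination ℕ A) (Finsupp.linearCombination ℕ A u))
        (Function.invFun_eq ⟨u, rfl⟩).symm)
      rwa [mul_sub, C_mul_monomial, C_mul_monomial, mul_one] at h
    | add p q hp hq =>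
      rw [map_add, AddMonoidAlgebra.mapDomain_add, add_sub_add_comm]
      exact J.add_mem hp hq
  intro p hp
  have := key p
  rw [RingHom.mem_ker] at hp
  rwa [hp, AddMonoidAlgebra.mapDomain_zero, sub_zero] at this

theorem ker_monomialMap_eq {m' : ℕ} (A' : σ → Fin m' → ℤ)
    (h : ∀ u v : σ →₀ ℕ, Finsupp.linearCombination ℕ A u = Finsupp.linearCombination ℕ A v ↔
      Finsupp.linearCombination ℕ A' u = Finsupp.linearCombination ℕ A' v) :
    RingHom.ker (monomialMap k A) = RingHom.ker (monomialMap k A') :=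
  le_antisymm
    (ker_monomialMap_le A fun u v huv => (binomial_mem_ker_monomialMap_iff A' u v).2 ((h u v).1 huv))
    (ker_monomialMap_le A' fun u v huv => (binomial_mem_ker_monomialMap_iff A u v).2 ((h u v).2 huv))

/-- An integer relation splits into its positive and negative parts, giving two natural combinations
with the same value. -/
theorem linearIndependent_nat_iff_int {M : Type*} [AddCommGroup M] (f : σ → M) :
    LinearIndependent ℕ f ↔ LinearIndependent ℤ f := by
  constructor
  · intro h
    rw [linearIndependent_iff]
    intro c hc
    have hp : ∀ d : σ →₀ ℕ, Finsupp.linearCombination ℕ f d =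
        Finsupp.linearCombination ℤ f (d.mapRange (fun n : ℕ => (n : ℤ)) rfl) := by
      intro d
      rw [Finsupp.linearCombination_apply, Finsupp.linearCombination_apply,
        Finsupp.sum_mapRange_index (by simp)]
      simp
    have hsub : (c.mapRange Int.toNat rfl).mapRange (fun n : ℕ => (n : ℤ)) rfl -
        ((-c).mapRange Int.toNat rfl).mapRange (fun n : ℕ => (n : ℤ)) rfl = c := by
      ext i
      simp
    have := congrArg (Finsupp.linearCombination ℤ f) hsub
    rw [map_sub, ← hp, ← hp, hc, sub_eq_zero] at this
    have := h this
    ext i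
    have := DFunLike.congr_fun this i
    simp at this
    simp
    omega
  · intro h
    exact h.restrict_scalars (R := ℕ) (by
      intro a b hab
      simpa using hab)

/-- The vectors of a family of exponents, with rational coordinates. -/
def ratFamily (i : σ) : Fin m → ℚ := fun l => (A i l : ℚ)

theorem linearIndependent_int_iff_rat :
    LinearIndependent ℤ A ↔ LinearIndependent ℚ (ratFamily A) := by
  rw [← LinearIndependent.iff_fractionRing ℤ ℚ]
  let c : (Fin m → ℤ) →ₗ[ℤ] (Fin m → ℚ) := (Algebra.linearMap ℤ ℚ).compLeft (Fin m)
  have hc : LinearMap.ker c = ⊥ := by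
    rw [LinearMap.ker_eq_bot]
    intro a b hab
    ext l
    have := congrFun hab l
    simpa [c] using this
  exact (c.linearIndependent_iff hc).symm

theorem algebraicIndependent_laurentMonomial_iff :
    AlgebraicIndependent k (fun i => laurentMonomial k (A i)) ↔
      LinearIndependent ℚ (ratFamily A) := by
  rw [← linearIndependent_int_iff_rat, ← linearIndependent_nat_iff_int]
  change Function.Injective (monomialMap k A) ↔ Function.Injective (Finsupp.linearCombination ℕ A)
  constructor
  · intro h u v huv
    have h1 : monomial u (1 : k) = monomial v 1 :=
      h (by rw [monomialMap_monomial, monomialMap_monomial, huv])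
    exact monomial_left_injective one_ne_zero h1
  · intro h
    rw [monomialMap_eq_mapDomainAlgHom]
    exact AddMonoidAlgebra.mapDomain_injective h

end Exponents

/-! ### Dimension as rank -/

section Dimension

variable {k : Type*} [Field k] {σ : Type*} [Finite σ] {m : ℕ} (A : σ → Fin m → ℤ)

/-- The dimension of a toric ring is the rank of its exponents. -/
theorem ringKrullDim_quotient_ker_monomialMap :
    ringKrullDim (MvPolynomial σ k ⧸ RingHom.ker (monomialMap k A)) =
      Module.finrank ℚ (Submodule.span ℚ (Set.range (ratFamily A))) := by
  let B := (monomialMap k A).range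
  have e : (MvPolynomial σ k ⧸ RingHom.ker (monomialMap k A)) ≃+* B :=
    (Ideal.quotientKerEquivRange (monomialMap k A)).toRingEquiv
  rw [ringKrullDim_eq_of_ringEquiv e]
  have hft : Algebra.FiniteType k B :=
    Algebra.FiniteType.of_surjective (monomialMap k A).rangeRestrict
      (monomialMap k A).rangeRestrict_surjective
  let y : σ → B := fun i => (monomialMap k A).rangeRestrict (X i)
  have hy : ∀ i, (y i : Laurent k m) = laurentMonomial k (A i) := fun i => by
    change monomialMap k A (X i) = _
    simp [monomialMap]
  have hAI : ∀ (s : Set B) (a : s → σ), (∀ b, y (a b) = b) →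
      (AlgebraicIndependent k ((↑) : s → B) ↔ LinearIndependent ℚ (ratFamily (A ∘ a))) := by
    intro s a ha
    rw [← algebraicIndependent_laurentMonomial_iff (k := k),
      ← AlgHom.algebraicIndependent_iff B.val Subtype.val_injective]
    have : (fun i => laurentMonomial k ((A ∘ a) i)) = B.val ∘ ((↑) : s → B) := by
      funext b
      simp [← hy, ha]
    rw [this]
  have hadj : Algebra.adjoin k (Set.range y) = ⊤ := by
    have : Set.range y = (monomialMap k A).rangeRestrict '' Set.range X := by
      rw [← Set.range_comp]; rfl
    rw [this, ← AlgHom.map_adjoin, MvPolynomial.adjoin_range_X, Algebra.map_top]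
    exact (AlgHom.range_eq_top _).2 (monomialMap k A).rangeRestrict_surjective
  have halg : Algebra.IsAlgebraic (Algebra.adjoin k (Set.range y)) B :=
    ⟨fun b => isAlgebraic_algebraMap (⟨b, hadj ▸ Algebra.mem_top⟩ : Algebra.adjoin k (Set.range y))⟩
  obtain ⟨κ, a, ha, hspan, hli⟩ := exists_linearIndependent' ℚ (ratFamily A)
  have : Finite κ := Finite.of_injective a ha
  -- Injectivity lets the independent family be treated as a subset of `B`.
  have hinj : Function.Injective (y ∘ a) := by
    intro i j hij
    have h := congrArg Subtype.val hij
    simp only [Function.comp_apply, hy] at h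
    have h' : A (a i) = A (a j) := AddMonoidAlgebra.single_left_injective one_ne_zero h
    apply hli.injective
    funext l
    simp [ratFamily, h']
  let E := Equiv.ofInjective _ hinj
  have hs : AlgebraicIndepOn k id (Set.range (y ∘ a)) := by
    refine (hAI (Set.range (y ∘ a)) (a ∘ E.symm) fun b => ?_).2 ?_
    · exact congrArg Subtype.val (E.apply_symm_apply b)
    · exact hli.comp _ E.symm.injective
  -- The transcendence basis is chosen among the generators: independence of its exponents bounds
  -- its size by the rank, and containing `y ∘ a` gives the reverse bound.
  obtain ⟨u, hsu, hut, hu⟩ := exists_isTranscendenceBasis_between (Set.range (y ∘ a)) (Set.range y)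
    (Set.range_comp_subset_range a y) hs
  have : Finite u := (Set.finite_range y).subset hut
  rw [ringKrullDim_eq_card_of_isTranscendenceBasis k B hu]
  choose c hc using fun b : u => hut b.2
  have hlu := (hAI u c hc).1 hu.1
  congr 1
  apply le_antisymm
  · have := Fintype.ofFinite u
    rw [Nat.card_eq_fintype_card, ← finrank_span_eq_card hlu]
    exact Submodule.finrank_mono (Submodule.span_mono (Set.range_comp_subset_range c (ratFamily A)))
  · have := Fintype.ofFinite κ
    rw [← hspan, finrank_span_eq_card hli, ← Nat.card_eq_fintype_card, Nat.card_congr E]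
    exact Nat.card_mono (Set.toFinite u) hsu

end Dimension

/-! ### Exponents of height one -/

section Homogenization

variable {k : Type*} [Field k] {σ : Type*} {m : ℕ}

/-- The exponents `(1, A i)`. -/
def homogenization (A : σ → Fin m → ℤ) (i : σ) : Fin (m + 1) → ℤ :=
  Fin.cons 1 (A i)

theorem linearCombination_homogenization (A : σ → Fin m → ℤ) (u : σ →₀ ℕ) :
    Finsupp.linearCombination ℕ (homogenization A) u =
      Fin.cons (u.degree : ℤ) (Finsupp.linearCombination ℕ A u) := by
  funext l
  simp only [Finsupp.linearCombination_apply, Finsupp.sum, Finset.sum_apply, Pi.smul_apply]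
  refine Fin.cases ?_ (fun l => ?_) l
  · simp [homogenization, Finsupp.degree_apply]
  · simp [homogenization]

theorem linearCombination_homogenization_eq_iff (A : σ → Fin m → ℤ) (u v : σ →₀ ℕ) :
    Finsupp.linearCombination ℕ (homogenization A) u =
      Finsupp.linearCombination ℕ (homogenization A) v ↔
    u.degree = v.degree ∧
      Finsupp.linearCombination ℕ A u = Finsupp.linearCombination ℕ A v := by
  rw [linearCombination_homogenization, linearCombination_homogenization, Fin.cons_inj]
  simp

/-- In a homogeneous toric ideal, both monomials of a binomial have the same degree. -/
theorem degree_eq_of_linearCombination_eq (A : σ → Fin m → ℤ)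
    (hA : IsHomogeneousIdeal (RingHom.ker (monomialMap k A))) {u v : σ →₀ ℕ}
    (h : Finsupp.linearCombination ℕ A u = Finsupp.linearCombination ℕ A v) :
    u.degree = v.degree := by
  classical
  by_contra hne
  -- For distinct degrees, this component is the monomial of `u` alone, whose image is nonzero.
  have hmem := homogeneousComponent_mem_of_mem hA
    ((binomial_mem_ker_monomialMap_iff (k := k) A u v).2 h) u.degree
  rw [map_sub, homogeneousComponent_of_mem (isHomogeneous_monomial 1 rfl),
    homogeneousComponent_of_mem (isHomogeneous_monomial 1 rfl), if_pos rfl, if_neg hne,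
    sub_zero, RingHom.mem_ker, monomialMap_monomial, AddMonoidAlgebra.single_eq_zero] at hmem
  exact one_ne_zero hmem

/-- A homogeneous toric ideal is the kernel for exponents `(1, A i)` in which one prescribed
vector `A i₀` vanishes. -/
theorem exists_ker_homogenization_eq {I : Ideal (MvPolynomial σ k)} (hI : IsToric I)
    (hom : IsHomogeneousIdeal I) (i₀ : σ) :
    ∃ (m : ℕ) (A : σ → Fin m → ℤ), A i₀ = 0 ∧
      RingHom.ker (monomialMap k (homogenization A)) = I := by
  obtain ⟨m, A, rfl⟩ := hI
  refine ⟨m, fun i => A i - A i₀, sub_self _, ker_monomialMap_eq _ _ fun u v => ?_⟩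
  have key : ∀ w : σ →₀ ℕ, Finsupp.linearCombination ℕ (fun i => A i - A i₀) w =
      Finsupp.linearCombination ℕ A w - w.degree • A i₀ := by
    intro w
    simp [Finsupp.linearCombination_apply, Finsupp.sum, smul_sub, Finset.sum_sub_distrib,
      Finsupp.degree_apply, Finset.sum_smul]
  rw [linearCombination_homogenization_eq_iff, key, key]
  constructor
  · rintro ⟨hd, h⟩
    rwa [hd, sub_left_inj] at h
  · intro h
    have hd := degree_eq_of_linearCombination_eq A hom h
    exact ⟨hd, by rw [hd, h]⟩

/-- A coincidence `A i = A j` puts `X i - X j` in the ideal, so every parametrization repeats a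
generator, including the minimal one. -/
theorem injective_of_isMinimallyToric {A : σ → Fin m → ℤ}
    (h : IsMinimallyToric (RingHom.ker (monomialMap k (homogenization A)))) :
    Function.Injective A := by
  obtain ⟨m', A', hmin, hker⟩ := h
  intro i j hij
  by_contra hne
  have h1 := (binomial_mem_ker_monomialMap_iff (k := k) (homogenization A)
    (Finsupp.single i 1) (Finsupp.single j 1)).2 (by simp [homogenization, hij])
  rw [← hker, binomial_mem_ker_monomialMap_iff] at h1
  simp only [Finsupp.linearCombination_single, one_smul] at h1
  refine hmin i ?_
  rw [h1]
  exact Algebra.subset_adjoin ⟨j, fun h => hne h.symm, rfl⟩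

theorem isMinimalFamily_homogenization {A : σ → Fin m → ℤ} (hA : Function.Injective A) :
    IsMinimalFamily k (homogenization A) := by
  intro i hi
  let S : Set (Fin (m + 1) → ℤ) := homogenization A '' {j | j ≠ i}
  have himg : (fun j => laurentMonomial k (homogenization A j)) '' {j | j ≠ i} =
      AddMonoidAlgebra.of' k (Fin (m + 1) → ℤ) '' S := by
    rw [← Set.image_comp]
    rfl
  have hmem : homogenization A i ∈ AddSubmonoid.closure S := by
    rw [himg, ← Subalgebra.mem_toSubmodule, Algebra.adjoin_eq_span] at hi
    exact AddMonoidAlgebra.mem_closure_of_mem_span_closure hi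
  -- Coordinate 0 grades the monoid. The height 0 clause is what forces a sum of height 1 to have a
  -- zero summand.
  have hcl : ∀ c ∈ AddSubmonoid.closure S, 0 ≤ c 0 ∧ (c 0 = 0 → c = 0) ∧ (c 0 = 1 → c ∈ S) := by
    intro c hc
    induction hc using AddSubmonoid.closure_induction with
    | mem c hc =>
      have : c 0 = 1 := by
        obtain ⟨j, -, rfl⟩ := hc
        rfl
      simp [this, hc]
    | zero => simp
    | add a b _ _ ha hb =>
      simp only [Pi.add_apply]
      refine ⟨add_nonneg ha.1 hb.1, fun h => ?_, fun h => ?_⟩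
      · rw [ha.2.1 (by lia), hb.2.1 (by lia), add_zero]
      · rcases (show a 0 = 0 ∨ b 0 = 0 by lia) with h0 | h0
        · rw [ha.2.1 h0, zero_add]
          exact hb.2.2 (by lia)
        · rw [hb.2.1 h0, add_zero]
          exact ha.2.2 (by lia)
  obtain ⟨j, hj, hji⟩ := (hcl _ hmem).2.2 rfl
  exact hj (hA (Fin.cons_inj.1 hji).2)

theorem finrank_map_prod {K V W U : Type*} [Field K] [AddCommGroup V] [Module K V]
    [AddCommGroup W] [Module K W] [AddCommGroup U] [Module K U] [FiniteDimensional K V]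
    [FiniteDimensional K W] (e : (V × W) ≃ₗ[K] U) (p : Submodule K V) (q : Submodule K W) :
    Module.finrank K ((p.prod q).map e.toLinearMap) = Module.finrank K p + Module.finrank K q := by
  let f : (p.prod q) ≃ₗ[K] p × q :=
    { toFun x := (⟨x.1.1, x.2.1⟩, ⟨x.1.2, x.2.2⟩)
      invFun y := ⟨(y.1, y.2), y.1.2, y.2.2⟩
      map_add' _ _ := rfl
      map_smul' _ _ := rfl }
  rw [e.finrank_map_eq, f.finrank_eq, Module.finrank_prod]

/-- The rank of the exponents `(1, A i)` when some `A i₀` vanishes. -/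
theorem finrank_span_homogenization (A : σ → Fin m → ℤ) {i₀ : σ}
    (h₀ : A i₀ = 0) :
    Module.finrank ℚ (Submodule.span ℚ (Set.range (ratFamily (homogenization A)))) =
      Module.finrank ℚ (Submodule.span ℚ (Set.range (ratFamily A))) + 1 := by
  let e : (ℚ × (Fin m → ℚ)) ≃ₗ[ℚ] (Fin (m + 1) → ℚ) := Fin.consLinearEquiv ℚ (fun _ => ℚ)
  have he : ∀ i, ratFamily (homogenization A) i = e (1, ratFamily A i) := by
    intro i
    funext l
    refine Fin.cases ?_ (fun l => ?_) l <;> simp [ratFamily, homogenization, e]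
  have h : Submodule.span ℚ (Set.range (ratFamily (homogenization A))) =
      ((⊤ : Submodule ℚ ℚ).prod (Submodule.span ℚ (Set.range (ratFamily A)))).map
        e.toLinearMap := by
    apply le_antisymm
    · rw [Submodule.span_le]
      rintro _ ⟨i, rfl⟩
      exact ⟨(1, ratFamily A i), ⟨trivial, Submodule.subset_span ⟨i, rfl⟩⟩, (he i).symm⟩
    -- The vanishing vector supplies `(1, 0)`; subtracting it from `(1, A i)` isolates `(0, A i)`.
    · have h10 : e (1, 0) ∈ Submodule.span ℚ (Set.range (ratFamily (homogenization A))) := by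
        refine Submodule.subset_span ⟨i₀, ?_⟩
        rw [he]
        congr 2
        funext l
        simp [ratFamily, h₀]
      have hsnd : Submodule.span ℚ (Set.range (ratFamily A)) ≤
          (Submodule.span ℚ (Set.range (ratFamily (homogenization A)))).comap
            (e.toLinearMap ∘ₗ LinearMap.inr ℚ ℚ (Fin m → ℚ)) := by
        rw [Submodule.span_le]
        rintro _ ⟨i, rfl⟩
        have := Submodule.sub_mem _ (Submodule.subset_span (Set.mem_range.2 ⟨i, he i⟩)) h10
        rw [← map_sub] at this
        simpa using this
      rintro _ ⟨⟨c, w⟩, ⟨-, hw⟩, rfl⟩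
      have := Submodule.add_mem _ (Submodule.smul_mem _ c h10) (hsnd hw)
      simpa [← map_smul, ← map_add] using this
  rw [h, finrank_map_prod, finrank_top, Module.finrank_self, add_comm]

theorem ringKrullDim_quotient_ker_homogenization [Finite σ] (A : σ → Fin m → ℤ) {i₀ : σ}
    (h₀ : A i₀ = 0) :
    ringKrullDim (MvPolynomial σ k ⧸ RingHom.ker (monomialMap k (homogenization A))) =
      Module.finrank ℚ (Submodule.span ℚ (Set.range (ratFamily A))) + 1 := by
  rw [ringKrullDim_quotient_ker_monomialMap, finrank_span_homogenization A h₀]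
  norm_cast

end Homogenization

/-! ### Gluing along the common variable -/

section Gluing

variable {k : Type*} [Field k] {σ₁ σ₂ : Type*} {m₁ m₂ : ℕ}

/-- The family of `A₁` and `A₂` in complementary coordinate spaces, the vectors of index `none`
being identified to zero. -/
def glue (A₁ : Option σ₁ → Fin m₁ → ℤ) (A₂ : Option σ₂ → Fin m₂ → ℤ) :
    Option (σ₁ ⊕ σ₂) → Fin (m₁ + m₂) → ℤ
  | none => 0
  | some (Sum.inl i) => Fin.append (A₁ (some i)) 0
  | some (Sum.inr j) => Fin.append 0 (A₂ (some j))

variable {A₁ : Option σ₁ → Fin m₁ → ℤ} {A₂ : Option σ₂ → Fin m₂ → ℤ}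

theorem glue_map_inl (h₁ : A₁ none = 0) (i : Option σ₁) :
    glue A₁ A₂ (i.map Sum.inl) = Fin.append (A₁ i) 0 := by
  cases i with
  | none =>
    rw [h₁]
    funext l
    refine Fin.addCases (fun l => ?_) (fun l => ?_) l <;> simp [glue]
  | some i => rfl

theorem glue_map_inr (h₂ : A₂ none = 0) (j : Option σ₂) :
    glue A₁ A₂ (j.map Sum.inr) = Fin.append 0 (A₂ j) := by
  cases j with
  | none =>
    rw [h₂]
    funext l
    refine Fin.addCases (fun l => ?_) (fun l => ?_) l <;> simp [glue]
  | some i => rfl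

theorem exists_eq_map_inl_or_inr (s : Option (σ₁ ⊕ σ₂)) :
    (∃ i : Option σ₁, s = i.map Sum.inl) ∨ ∃ j : Option σ₂, s = j.map Sum.inr := by
  rcases s with _ | i | j
  · exact .inl ⟨none, rfl⟩
  · exact .inl ⟨some i, rfl⟩
  · exact .inr ⟨some j, rfl⟩

theorem glue_injective (h₁ : A₁ none = 0) (h₂ : A₂ none = 0) (hA₁ : Function.Injective A₁)
    (hA₂ : Function.Injective A₂) : Function.Injective (glue A₁ A₂) := by
  -- Vectors from the two sides can meet only at zero, which by injectivity is the vector of `x`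
  -- alone.
  have key : ∀ i j, Fin.append (A₁ i) (0 : Fin m₂ → ℤ) = Fin.append 0 (A₂ j) →
      i = none ∧ j = none := by
    intro i j h
    constructor
    · apply hA₁
      rw [h₁]
      funext l
      simpa using congrFun h (Fin.castAdd m₂ l)
    · apply hA₂
      rw [h₂]
      funext l
      simpa using (congrFun h (Fin.natAdd m₁ l)).symm
  have hl : ∀ i i', Fin.append (A₁ i) (0 : Fin m₂ → ℤ) = Fin.append (A₁ i') 0 → i = i' := by
    intro i j h
    apply hA₁
    funext l
    simpa using congrFun h (Fin.castAdd m₂ l)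
  have hr : ∀ i i', Fin.append (0 : Fin m₁ → ℤ) (A₂ i) = Fin.append 0 (A₂ i') → i = i' := by
    intro i j h
    apply hA₂
    funext l
    simpa using congrFun h (Fin.natAdd m₁ l)
  intro s t hst
  rcases exists_eq_map_inl_or_inr s with ⟨i, rfl⟩ | ⟨i, rfl⟩ <;>
    rcases exists_eq_map_inl_or_inr t with ⟨j, rfl⟩ | ⟨j, rfl⟩ <;>
    simp only [glue_map_inl h₁, glue_map_inr h₂] at hst
  · rw [hl _ _ hst]
  · obtain ⟨rfl, rfl⟩ := key _ _ hst
    rfl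
  · obtain ⟨rfl, rfl⟩ := key _ _ hst.symm
    rfl
  · rw [hr _ _ hst]

/-- The rank of glued exponents. -/
theorem finrank_span_glue (h₁ : A₁ none = 0) (h₂ : A₂ none = 0) :
    Module.finrank ℚ (Submodule.span ℚ (Set.range (ratFamily (glue A₁ A₂)))) =
      Module.finrank ℚ (Submodule.span ℚ (Set.range (ratFamily A₁))) +
        Module.finrank ℚ (Submodule.span ℚ (Set.range (ratFamily A₂))) := by
  let e : ((Fin m₁ → ℚ) × (Fin m₂ → ℚ)) ≃ₗ[ℚ] (Fin (m₁ + m₂) → ℚ) :=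
    { Fin.appendEquiv m₁ m₂ with
      map_add' := fun x y => by
        funext l
        refine Fin.addCases (fun l => ?_) (fun l => ?_) l <;> simp [Fin.appendEquiv]
      map_smul' := fun c x => by
        funext l
        refine Fin.addCases (fun l => ?_) (fun l => ?_) l <;> simp [Fin.appendEquiv] }
  have hl : ∀ i : Option σ₁, ratFamily (glue A₁ A₂) (i.map Sum.inl) = e (ratFamily A₁ i, 0) := by
    intro i
    funext l
    refine Fin.addCases (fun l => ?_) (fun l => ?_) l <;>
      simp [e, ratFamily, Fin.appendEquiv, glue_map_inl h₁]
  have hr : ∀ i : Option σ₂, ratFamily (glue A₁ A₂) (i.map Sum.inr) = e (0, ratFamily A₂ i) := by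
    intro i
    funext l
    refine Fin.addCases (fun l => ?_) (fun l => ?_) l <;>
      simp [e, ratFamily, Fin.appendEquiv, glue_map_inr h₂]
  have hinl : Submodule.span ℚ (Set.range (ratFamily A₁)) ≤
      (Submodule.span ℚ (Set.range (ratFamily (glue A₁ A₂)))).comap
        (e.toLinearMap ∘ₗ LinearMap.inl ℚ (Fin m₁ → ℚ) (Fin m₂ → ℚ)) := by
    rw [Submodule.span_le]
    rintro _ ⟨i, rfl⟩
    exact Submodule.subset_span ⟨_, hl i⟩
  have hinr : Submodule.span ℚ (Set.range (ratFamily A₂)) ≤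
      (Submodule.span ℚ (Set.range (ratFamily (glue A₁ A₂)))).comap
        (e.toLinearMap ∘ₗ LinearMap.inr ℚ (Fin m₁ → ℚ) (Fin m₂ → ℚ)) := by
    rw [Submodule.span_le]
    rintro _ ⟨i, rfl⟩
    exact Submodule.subset_span ⟨_, hr i⟩
  have h : Submodule.span ℚ (Set.range (ratFamily (glue A₁ A₂))) =
      ((Submodule.span ℚ (Set.range (ratFamily A₁))).prod
        (Submodule.span ℚ (Set.range (ratFamily A₂)))).map e.toLinearMap := by
    apply le_antisymm
    · rw [Submodule.span_le]
      rintro _ ⟨s, rfl⟩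
      rcases exists_eq_map_inl_or_inr s with ⟨i, rfl⟩ | ⟨i, rfl⟩
      · exact ⟨_, ⟨Submodule.subset_span ⟨i, rfl⟩, zero_mem _⟩, (hl i).symm⟩
      · exact ⟨_, ⟨zero_mem _, Submodule.subset_span ⟨i, rfl⟩⟩, (hr i).symm⟩
    · rintro _ ⟨⟨v, w⟩, ⟨hv, hw⟩, rfl⟩
      have hv' : e (v, 0) ∈ Submodule.span ℚ (Set.range (ratFamily (glue A₁ A₂))) := hinl hv
      have hw' : e (0, w) ∈ Submodule.span ℚ (Set.range (ratFamily (glue A₁ A₂))) := hinr hw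
      have := Submodule.add_mem _ hv' hw'
      simpa [← map_add] using this
  rw [h, finrank_map_prod]

theorem linearCombination_glue (h₁ : A₁ none = 0) (h₂ : A₂ none = 0)
    (u : Option σ₁ →₀ ℕ) (v : Option σ₂ →₀ ℕ) :
    Finsupp.linearCombination ℕ (glue A₁ A₂)
        (u.mapDomain (Option.map Sum.inl) + v.mapDomain (Option.map Sum.inr)) =
      Fin.append (Finsupp.linearCombination ℕ A₁ u) (Finsupp.linearCombination ℕ A₂ v) := by
  rw [map_add, Finsupp.linearCombination_mapDomain, Finsupp.linearCombination_mapDomain]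
  funext l
  simp only [Pi.add_apply, Finsupp.linearCombination_apply, Finsupp.sum, Finset.sum_apply,
    Pi.smul_apply, Function.comp_apply, glue_map_inl h₁, glue_map_inr h₂]
  refine Fin.addCases (fun l => ?_) (fun l => ?_) l <;> simp

/-- The splitting is not unique, since powers of `x` may go to either side; any choice serves. -/
theorem exists_eq_mapDomain_add_mapDomain (w : Option (σ₁ ⊕ σ₂) →₀ ℕ) :
    ∃ (u : Option σ₁ →₀ ℕ) (v : Option σ₂ →₀ ℕ),
      w = u.mapDomain (Option.map Sum.inl) + v.mapDomain (Option.map Sum.inr) := by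
  induction w using Finsupp.induction_linear with
  | zero => exact ⟨0, 0, by simp⟩
  | add a b ha hb =>
    obtain ⟨u, v, rfl⟩ := ha
    obtain ⟨u', v', rfl⟩ := hb
    refine ⟨u + u', v + v', ?_⟩
    rw [Finsupp.mapDomain_add, Finsupp.mapDomain_add]
    abel
  | single i n =>
    rcases i with (_ | i | j)
    · exact ⟨Finsupp.single none n, 0, by simp⟩
    · exact ⟨Finsupp.single (some i) n, 0, by simp⟩
    · exact ⟨0, Finsupp.single (some j) n, by simp⟩

/-- The sum of two homogeneous toric ideals is the toric ideal of the glued exponents. -/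
theorem sumIdeal_eq_ker (h₁ : A₁ none = 0) (h₂ : A₂ none = 0) :
    sumIdeal (RingHom.ker (monomialMap k (homogenization A₁)))
        (RingHom.ker (monomialMap k (homogenization A₂))) =
      RingHom.ker (monomialMap k (homogenization (glue A₁ A₂))) := by
  set J := sumIdeal (RingHom.ker (monomialMap k (homogenization A₁)))
    (RingHom.ker (monomialMap k (homogenization A₂))) with hJ
  apply le_antisymm
  · rw [hJ, sumIdeal, Submodule.add_eq_sup, sup_le_iff, Ideal.map_le_iff_le_comap,
      Ideal.map_le_iff_le_comap]
    constructor
    · refine ker_monomialMap_le _ fun u v huv => ?_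
      rw [linearCombination_homogenization_eq_iff] at huv
      rw [Ideal.mem_comap, map_sub, inclLeft, rename_monomial, rename_monomial,
        binomial_mem_ker_monomialMap_iff, linearCombination_homogenization_eq_iff,
        Finsupp.degree_mapDomain, Finsupp.degree_mapDomain]
      have hu := linearCombination_glue (A₁ := A₁) (A₂ := A₂) h₁ h₂ u 0
      have hv := linearCombination_glue (A₁ := A₁) (A₂ := A₂) h₁ h₂ v 0
      rw [Finsupp.mapDomain_zero, add_zero] at hu hv
      exact ⟨huv.1, by rw [hu, hv, huv.2]⟩
    · refine ker_monomialMap_le _ fun u v huv => ?_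
      rw [linearCombination_homogenization_eq_iff] at huv
      rw [Ideal.mem_comap, map_sub, inclRight, rename_monomial, rename_monomial,
        binomial_mem_ker_monomialMap_iff, linearCombination_homogenization_eq_iff,
        Finsupp.degree_mapDomain, Finsupp.degree_mapDomain]
      have hu := linearCombination_glue (A₁ := A₁) (A₂ := A₂) h₁ h₂ 0 u
      have hv := linearCombination_glue (A₁ := A₁) (A₂ := A₂) h₁ h₂ 0 v
      rw [Finsupp.mapDomain_zero, zero_add] at hu hv
      exact ⟨huv.1, by rw [hu, hv, huv.2]⟩
  -- Since `A₁ none = 0`, the factor `X none ^ d` corrects the degree and leaves the other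
  -- coordinates unchanged.
  · have hL : ∀ (p p' : Option σ₁ →₀ ℕ) (d : ℕ), p'.degree = p.degree + d →
        Finsupp.linearCombination ℕ A₁ p = Finsupp.linearCombination ℕ A₁ p' →
        inclLeft k σ₁ σ₂ (monomial p 1) * X none ^ d - inclLeft k σ₁ σ₂ (monomial p' 1) ∈ J := by
      intro p p' d hd hpp
      have h := (binomial_mem_ker_monomialMap_iff (k := k) (homogenization A₁)
        (p + Finsupp.single none d) p').2 (by
          rw [linearCombination_homogenization_eq_iff, map_add, map_add,
            Finsupp.linearCombination_single, h₁, smul_zero, add_zero, Finsupp.degree_single]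
          exact ⟨hd.symm, hpp⟩)
      have h' := Ideal.mem_sup_left (T := (RingHom.ker (monomialMap k (homogenization A₂))).map
        (inclRight k σ₁ σ₂)) (Ideal.mem_map_of_mem (inclLeft k σ₁ σ₂) h)
      rw [map_sub, monomial_add_single, map_mul, map_pow] at h'
      have hX : inclLeft k σ₁ σ₂ (X none) = X none := by simp [inclLeft]
      rwa [hX] at h'
    have hR : ∀ (q q' : Option σ₂ →₀ ℕ) (d : ℕ), q.degree = q'.degree + d →
        Finsupp.linearCombination ℕ A₂ q = Finsupp.linearCombination ℕ A₂ q' →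
        inclRight k σ₁ σ₂ (monomial q 1) - inclRight k σ₁ σ₂ (monomial q' 1) * X none ^ d ∈ J := by
      intro q q' d hd hqq
      have h := (binomial_mem_ker_monomialMap_iff (k := k) (homogenization A₂)
        q (q' + Finsupp.single none d)).2 (by
          rw [linearCombination_homogenization_eq_iff, map_add, map_add,
            Finsupp.linearCombination_single, h₂, smul_zero, add_zero, Finsupp.degree_single]
          exact ⟨hd, hqq⟩)
      have h' := Ideal.mem_sup_right (S := (RingHom.ker (monomialMap k (homogenization A₁))).map
        (inclLeft k σ₁ σ₂)) (Ideal.mem_map_of_mem (inclRight k σ₁ σ₂) h)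
      rw [map_sub, monomial_add_single, map_mul, map_pow] at h'
      have hX : inclRight k σ₁ σ₂ (X none) = X none := by simp [inclRight]
      rwa [hX] at h'
    have hmon : ∀ (p : Option σ₁ →₀ ℕ) (q : Option σ₂ →₀ ℕ),
        monomial (p.mapDomain (Option.map Sum.inl) + q.mapDomain (Option.map Sum.inr)) (1 : k) =
          inclLeft k σ₁ σ₂ (monomial p 1) * inclRight k σ₁ σ₂ (monomial q 1) := by
      intro p q
      rw [inclLeft, inclRight, rename_monomial, rename_monomial, monomial_mul, one_mul]
    have main : ∀ (p p' : Option σ₁ →₀ ℕ) (q q' : Option σ₂ →₀ ℕ) (d : ℕ),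
        p'.degree = p.degree + d → q.degree = q'.degree + d →
        Finsupp.linearCombination ℕ A₁ p = Finsupp.linearCombination ℕ A₁ p' →
        Finsupp.linearCombination ℕ A₂ q = Finsupp.linearCombination ℕ A₂ q' →
        inclLeft k σ₁ σ₂ (monomial p 1) * inclRight k σ₁ σ₂ (monomial q 1) -
          inclLeft k σ₁ σ₂ (monomial p' 1) * inclRight k σ₁ σ₂ (monomial q' 1) ∈ J := by
      intro p p' q q' d hp hq hpp hqq
      have := J.add_mem
        (J.mul_mem_left (inclLeft k σ₁ σ₂ (monomial p 1)) (hR q q' d hq hqq))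
        (J.mul_mem_right (inclRight k σ₁ σ₂ (monomial q' 1)) (hL p p' d hp hpp))
      convert this using 1
      ring
    refine ker_monomialMap_le _ fun u v huv => ?_
    obtain ⟨p, q, rfl⟩ := exists_eq_mapDomain_add_mapDomain u
    obtain ⟨p', q', rfl⟩ := exists_eq_mapDomain_add_mapDomain v
    rw [linearCombination_homogenization_eq_iff, linearCombination_glue h₁ h₂,
      linearCombination_glue h₁ h₂, map_add, map_add, Finsupp.degree_mapDomain, Finsupp.degree_mapDomain,
      Finsupp.degree_mapDomain, Finsupp.degree_mapDomain] at huv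
    obtain ⟨hd, happ⟩ := huv
    have hpp : Finsupp.linearCombination ℕ A₁ p = Finsupp.linearCombination ℕ A₁ p' := by
      funext l
      simpa using congrFun happ (Fin.castAdd m₂ l)
    have hqq : Finsupp.linearCombination ℕ A₂ q = Finsupp.linearCombination ℕ A₂ q' := by
      funext l
      simpa using congrFun happ (Fin.natAdd m₁ l)
    rw [hmon, hmon]
    -- Equal total degrees make the left deficit equal to the right surplus; the other case swaps
    -- the two monomials.
    rcases le_total p.degree p'.degree with h | h
    · exact main p p' q q' (p'.degree - p.degree) (by lia) (by lia) hpp hqq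
    · rw [← J.neg_mem_iff, neg_sub]
      exact main p' p q' q (p.degree - p'.degree) (by lia) (by lia) hpp.symm hqq.symm

end Gluing

/-! ### Homogeneity of the sum -/

section Homogeneity

attribute [local instance] MvPolynomial.gradedAlgebra

variable {k : Type*} [Field k] {σ τ : Type*}

theorem IsHomogeneousIdeal.map_rename {I : Ideal (MvPolynomial σ k)} (hI : IsHomogeneousIdeal I)
    (f : σ → τ) : IsHomogeneousIdeal (I.map (rename f : MvPolynomial σ k →ₐ[k] MvPolynomial τ k)) := by
  obtain ⟨S, rfl⟩ := (Ideal.IsHomogeneous.iff_exists _ _).1 hI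
  rw [Ideal.map_span]
  refine Ideal.homogeneous_span _ _ ?_
  rintro _ ⟨_, ⟨p, -, rfl⟩, rfl⟩
  obtain ⟨n, hn⟩ := p.2
  exact ⟨n, IsHomogeneous.rename_isHomogeneous hn⟩

theorem IsHomogeneousIdeal.sumIdeal {σ₁ σ₂ : Type*} {I₁ : Ideal (MvPolynomial (Option σ₁) k)}
    {I₂ : Ideal (MvPolynomial (Option σ₂) k)} (h₁ : IsHomogeneousIdeal I₁)
    (h₂ : IsHomogeneousIdeal I₂) : IsHomogeneousIdeal (ToricSum.sumIdeal I₁ I₂) :=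
  Ideal.IsHomogeneous.sup (h₁.map_rename _) (h₂.map_rename _)

end Homogeneity

end ToricSum

theorem mainTheorem1 {k : Type*} [Field k] {σ₁ σ₂ : Type*} [Finite σ₁] [Finite σ₂]
    (I₁ : Ideal (MvPolynomial (Option σ₁) k)) (I₂ : Ideal (MvPolynomial (Option σ₂) k))
    (hI₁ : ToricSum.IsToric I₁) (hI₂ : ToricSum.IsToric I₂)
    (hom₁ : ToricSum.IsHomogeneousIdeal I₁) (hom₂ : ToricSum.IsHomogeneousIdeal I₂)
    (hx₁ : ToricSum.OccursInMinimalGenerators I₁ none)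
    (hx₂ : ToricSum.OccursInMinimalGenerators I₂ none) :
    (ToricSum.IsToric (ToricSum.sumIdeal I₁ I₂) ∧
      ToricSum.IsHomogeneousIdeal (ToricSum.sumIdeal I₁ I₂) ∧
      (ToricSum.IsMinimallyToric I₁ → ToricSum.IsMinimallyToric I₂ →
        ToricSum.IsMinimallyToric (ToricSum.sumIdeal I₁ I₂))) ∧
    ringKrullDim (MvPolynomial (Option (σ₁ ⊕ σ₂)) k ⧸ ToricSum.sumIdeal I₁ I₂) + 1 =
      ringKrullDim (MvPolynomial (Option σ₁) k ⧸ I₁) +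
        ringKrullDim (MvPolynomial (Option σ₂) k ⧸ I₂) := by
  have hom := hom₁.sumIdeal hom₂
  obtain ⟨m₁, A₁, h₁, rfl⟩ := ToricSum.exists_ker_homogenization_eq hI₁ hom₁ none
  obtain ⟨m₂, A₂, h₂, rfl⟩ := ToricSum.exists_ker_homogenization_eq hI₂ hom₂ none
  have hsum := ToricSum.sumIdeal_eq_ker (k := k) h₁ h₂
  refine ⟨⟨⟨_, _, hsum.symm⟩, hom, fun hm₁ hm₂ => ⟨_, _, ?_, hsum.symm⟩⟩, ?_⟩
  · exact ToricSum.isMinimalFamily_homogenization (ToricSum.glue_injective h₁ h₂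
      (ToricSum.injective_of_isMinimallyToric hm₁) (ToricSum.injective_of_isMinimallyToric hm₂))
  · have h₀ : ToricSum.glue A₁ A₂ none = 0 := rfl
    rw [hsum, ToricSum.ringKrullDim_quotient_ker_homogenization _ h₀,
      ToricSum.ringKrullDim_quotient_ker_homogenization _ h₁,
      ToricSum.ringKrullDim_quotient_ker_homogenization _ h₂, ToricSum.finrank_span_glue h₁ h₂]
    norm_cast
    ring_nf
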